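/- For integers $n\ge 3$ and $b\ge 0$, the $(1:b)$ rainbow spanning tree game $\mathcal{RS}_n$ is played as follows. The board is the disjoint union of the edge sets of $n-1$ copies $G_1,\dots,G_{n-1}$ of the complete graph $K_n$ on the vertex set $[n]$. Maker and Breaker alternately claim unclaimed elements of the board: in every round Maker first claims one element and then Breaker claims $b$ elements (all remaining ones if fewer than $b$ are left), until all elements are claimed. Maker wins if the elements she has claimed contain a rainbow spanning tree, that is, a spanning tree on $[n]$ with exactly one edge from each $G_i$; otherwise Breaker wins. For every $n\ge 3$ there is a unique integer $b_{\mathcal{RS}_n}$, the threshold bias, such that Breaker has a winning strategy in the $(1:b)$ game if and only if $b\ge b_{\mathcal{RS}_n}$, and, as $n\to\infty$, $$\left(\frac{\log 2}{8}-o(1)\right)\frac{n^2}{\log n}\;\le\; b_{\mathcal{RS}_n}\;\le\;(1+o(1))\,\frac{n^2}{\log n},$$ where $\log$ is the natural logarithm. -/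

import Mathlib

open Filter Topology

namespace MakerBreaker

/-- Breaker wins the `(1 : b)` Maker-Breaker game with winning sets `F` from the position in which
Maker has claimed `M`, Breaker has claimed `B`, and a new round starts (Maker is to move).
A derivation of this predicate is a winning strategy (as a strategy tree) for Breaker from that
position. In each round Maker claims one unclaimed element `x`, then Breaker claims the set
`answer x` of `b` unclaimed elements (all the remaining ones if there are fewer than `b`).
The game ends when the whole board is claimed, and Breaker has won if Maker then owns
no winning set completely. -/
inductive BreakerWinsFrom {X : Type*} [Fintype X] [DecidableEq X]
    (F : Set (Finset X)) (b : ℕ) : Finset X → Finset X → Prop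
  | finished (M B : Finset X) (full : M ∪ B = Finset.univ) (noWin : ∀ A ∈ F, ¬ A ⊆ M) :
      BreakerWinsFrom F b M B
  | round (M B : Finset X) (notFull : M ∪ B ≠ Finset.univ) (answer : X → Finset X)
      (answer_free : ∀ x, x ∉ M ∪ B → Disjoint (answer x) (insert x M ∪ B))
      (answer_card : ∀ x, x ∉ M ∪ B →
        (answer x).card = min b (insert x M ∪ B)ᶜ.card)
      (next : ∀ x, x ∉ M ∪ B → BreakerWinsFrom F b (insert x M) (B ∪ answer x)) :
      BreakerWinsFrom F b M B

/-- Breaker wins (has a winning strategy in) the `(1 : b)` Maker-Breaker game on the hypergraph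
with vertex set (board) `X` and set `F` of hyperedges (winning sets), Maker moving first. -/
def BreakerWins {X : Type*} [Fintype X] [DecidableEq X] (F : Set (Finset X)) (b : ℕ) : Prop :=
  BreakerWinsFrom F b ∅ ∅

/-- `t` is the threshold bias of the game with winning sets `F`: Breaker wins the `(1 : b)` game
if and only if `b ≥ t`. (There is at most one such `t`.) -/
def IsThresholdBias {X : Type*} [Fintype X] [DecidableEq X] (F : Set (Finset X)) (t : ℕ) : Prop :=
  ∀ b : ℕ, BreakerWins F b ↔ t ≤ b

/-- The board of the rainbow spanning tree game: the disjoint union of the edge sets of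
`n - 1` copies of the complete graph on `n` vertices. The element `(i, e)` is the copy of the
edge `e` in the `i`-th complete graph. -/
abbrev RainbowBoard (n : ℕ) : Type :=
  Fin (n - 1) × (⊤ : SimpleGraph (Fin n)).edgeSet

/-- `T` is a rainbow spanning tree: it contains exactly one edge from each of the `n - 1` copies,
and its edges form a spanning tree on the `n` vertices. (A tree on `n` vertices has `n - 1` edges,
so the `n - 1` elements of `T` are then copies of pairwise different edges.) -/
def IsRainbowSpanningTree {n : ℕ} (T : Finset (RainbowBoard n)) : Prop :=
  (∀ i : Fin (n - 1), ∃! p : RainbowBoard n, p ∈ T ∧ p.1 = i) ∧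
    (SimpleGraph.fromEdgeSet {e : Sym2 (Fin n) | ∃ p ∈ T, (p.2 : Sym2 (Fin n)) = e}).IsTree

/-- The winning sets of the rainbow spanning tree game. -/
def rainbowSpanningTrees (n : ℕ) : Set (Finset (RainbowBoard n)) :=
  {T | IsRainbowSpanningTree T}

end MakerBreaker

/-!
Breaker's side is the box game on the colours: Breaker wins once he has exhausted a colour in which
Maker has no edge. He always spreads his `b` elements evenly over the colours Maker has not
touched, so the last of them receives `b / (n - 2) + ⋯ + b / 1 ≈ b * log n` elements, and this
exceeds `n.choose 2 ≈ n ^ 2 / 2` when `b = n ^ 2 / log n`.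

For Maker, Rado's theorem in the cycle matroid produces a rainbow spanning tree unless for some set
`I` of colours the edges she has claimed in `I` have rank less than `#I`. If `I` is small, these
edges then live on fewer than `2 * #I` vertices, so Maker has missed all copies in `I` of the edges
not inside a small vertex set. If `I` is large, the graph they form has many components, a suitable
union of which is one side of a fairly balanced cut, and Maker has missed all copies in `I` of the
edges of that cut. The biased Erdős–Selfridge criterion lets Maker hit all sets of both kinds.
-/

namespace MakerBreaker

open Finset

section Game

variable {X : Type*} [Fintype X] [DecidableEq X] {F : Set (Finset X)} {b c : ℕ} {M B : Finset X}

theorem BreakerWinsFrom.not_subset (h : BreakerWinsFrom F b M B) : ∀ A ∈ F, ¬ A ⊆ M := by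
  induction h with
  | finished _ _ _ noWin => exact noWin
  | round M _ notFull _ _ _ _ ih =>
    obtain ⟨x, hx⟩ := not_forall.1 (mt eq_univ_iff_forall.2 notFull)
    exact fun A hA hAM => ih x hx A hA (hAM.trans (subset_insert x M))

theorem exists_superset_disjoint_card_eq_min {C Y : Finset X} (hYC : Disjoint Y C) (hYb : #Y ≤ b) :
    ∃ Z, Y ⊆ Z ∧ Disjoint Z C ∧ #Z = min b #Cᶜ := by
  have hY : Y ⊆ Cᶜ := subset_compl_iff_disjoint_right.2 hYC
  obtain ⟨Z, hYZ, hZC, hZ⟩ := exists_subsuperset_card_eq hY (le_min hYb (card_le_card hY))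
    (min_le_right b #Cᶜ)
  exact ⟨Z, hYZ, subset_compl_iff_disjoint_right.1 hZC, hZ⟩

theorem breakerWinsFrom_of_invariant {P : Finset X → Finset X → Prop} (mono : ∀ M, Monotone (P M))
    (noWin : ∀ M B, P M B → M ∪ B = univ → ∀ A ∈ F, ¬ A ⊆ M)
    (step : ∀ M B, P M B → ∀ x ∉ M ∪ B,
      ∃ Y, Disjoint Y (insert x M ∪ B) ∧ #Y ≤ b ∧ P (insert x M) (B ∪ Y))
    (h : P M B) : BreakerWinsFrom F b M B := by
  induction hk : #(M ∪ B)ᶜ using Nat.strong_induction_on generalizing M B with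
  | _ k ih =>
    by_cases full : M ∪ B = univ
    · exact .finished M B full (noWin M B h full)
    have exists_answer : ∀ x, ∃ Z, x ∉ M ∪ B → Disjoint Z (insert x M ∪ B) ∧
        #Z = min b #(insert x M ∪ B)ᶜ ∧ P (insert x M) (B ∪ Z) := by
      intro x
      by_cases hx : x ∈ M ∪ B
      · exact ⟨∅, fun h => absurd hx h⟩
      obtain ⟨Y, hY, hYb, hYP⟩ := step M B h x hx
      obtain ⟨Z, hYZ, hZ, hZb⟩ := exists_superset_disjoint_card_eq_min hY hYb
      exact ⟨Z, fun _ => ⟨hZ, hZb, mono _ (union_subset_union_right hYZ) hYP⟩⟩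
    choose answer hanswer using exists_answer
    refine .round M B full answer (fun x hx => (hanswer x hx).1)
      (fun x hx => (hanswer x hx).2.1) fun x hx => ih _ ?_ (hanswer x hx).2.2 rfl
    rw [← hk]
    have hsub : M ∪ B ⊆ insert x M ∪ (B ∪ answer x) :=
      union_subset_union (subset_insert x M) subset_union_left
    exact card_lt_card (compl_ssubset_compl.2
      (Finset.ssubset_iff_of_subset hsub |>.2 ⟨x, by simp, hx⟩))

theorem BreakerWins.mono (hbc : b ≤ c) (h : BreakerWins F b) : BreakerWins F c := by
  refine breakerWinsFrom_of_invariant (P := fun M B => ∃ B₀ ⊆ B, BreakerWinsFrom F b M B₀)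
    ?_ ?_ ?_ ⟨∅, subset_rfl, h⟩
  · rintro M B B' hB ⟨B₀, hB₀, hwin⟩
    exact ⟨B₀, hB₀.trans hB, hwin⟩
  · rintro M B ⟨B₀, -, hwin⟩ -
    exact hwin.not_subset
  · rintro M B ⟨B₀, hB₀, hwin⟩ x hx
    have hx₀ : x ∉ M ∪ B₀ := fun h => hx (union_subset_union_right hB₀ h)
    cases hwin with
    | finished _ _ full _ => exact absurd (full ▸ mem_univ x) hx₀
    | round _ _ _ answer free card next =>
      refine ⟨answer x \ B, ?_, ?_, B₀ ∪ answer x, ?_, next x hx₀⟩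
      · have := free x hx₀
        grind [Finset.disjoint_left]
      · calc #(answer x \ B) ≤ #(answer x) := card_le_card sdiff_subset
          _ ≤ b := (card x hx₀).trans_le (min_le_left _ _)
          _ ≤ c := hbc
      · rw [union_sdiff_self_eq_union]
        exact union_subset_union_left hB₀

theorem exists_isThresholdBias (h : ∃ b, BreakerWins F b) : ∃ t, IsThresholdBias F t := by
  classical
  exact ⟨Nat.find h, fun b => ⟨Nat.find_min' h, (Nat.find_spec h).mono⟩⟩

end Game

section BoxGame

/-- The capacity of the `k`-box game with bias `b`: the number of elements of the last surviving
box that Breaker can claim if, while `l` boxes survive, he claims `b / l` elements of each. -/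
def boxCapacity (b k : ℕ) : ℕ := ∑ l ∈ Ico 1 k, b / l

theorem boxCapacity_succ (b : ℕ) {k : ℕ} (hk : 1 ≤ k) :
    boxCapacity b (k + 1) = boxCapacity b k + b / k :=
  sum_Ico_succ_top hk _

theorem mul_log_sub_le_boxCapacity (b k : ℕ) : (b : ℝ) * Real.log k - k ≤ boxCapacity b k := by
  rcases k with _ | m
  · simp [boxCapacity]
  have floor_bound (l : ℕ) : (b : ℝ) * (l : ℝ)⁻¹ - 1 ≤ (b / l : ℕ) := by
    have := Nat.lt_floor_add_one ((b : ℝ) / l)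
    rw [Nat.floor_div_eq_div] at this
    rw [← div_eq_mul_inv]
    linarith
  calc (b : ℝ) * Real.log (m + 1 : ℕ) - (m + 1 : ℕ)
      ≤ b * (harmonic m : ℚ) - m := by
        have := mul_le_mul_of_nonneg_left (log_add_one_le_harmonic m) (Nat.cast_nonneg (α := ℝ) b)
        push_cast at this ⊢
        linarith
    _ = ∑ l ∈ Ico 1 (m + 1), ((b : ℝ) * (l : ℝ)⁻¹ - 1) := by
        rw [sum_sub_distrib, ← mul_sum, harmonic_eq_sum_Icc, Ico_add_one_right_eq_Icc]
        simp
    _ ≤ ∑ l ∈ Ico 1 (m + 1), ((b / l : ℕ) : ℝ) := sum_le_sum fun l _ => floor_bound l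
    _ = boxCapacity b (m + 1) := by rw [boxCapacity, Nat.cast_sum]

variable {X ι : Type*} [Fintype X] [DecidableEq X] [DecidableEq ι]

/-- The elements of the `i`-th box `c ⁻¹ {i}` that Breaker does not own. -/
def openBox (c : X → ι) (B : Finset X) (i : ι) : Finset X := {x ∈ Bᶜ | c x = i}

variable {F : Set (Finset X)} {b : ℕ} {M B : Finset X} {c : X → ι}

theorem mem_openBox {i : ι} {x : X} : x ∈ openBox c B i ↔ x ∉ B ∧ c x = i := by
  simp only [openBox, mem_filter, mem_compl]

theorem openBox_anti {B' : Finset X} (h : B ⊆ B') (i : ι) : openBox c B' i ⊆ openBox c B i :=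
  filter_subset_filter _ (compl_subset_compl.2 h)

theorem exists_card_openBox_union_le (c : X → ι) (b : ℕ) (B : Finset X) (S : Finset ι) :
    ∃ Y : Finset X, #Y ≤ b ∧ (∀ y ∈ Y, y ∉ B ∧ c y ∈ S) ∧
      ∀ i ∈ S, #(openBox c (B ∪ Y) i) ≤ #(openBox c B i) - b / #S := by
  have exists_share (i : ι) : ∃ Y ⊆ openBox c B i, #Y = min (b / #S) #(openBox c B i) :=
    exists_subset_card_eq (min_le_right _ _)
  choose share share_sub card_share using exists_share
  refine ⟨S.biUnion share, ?_, ?_, fun i hi => ?_⟩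
  · calc #(S.biUnion share) ≤ #S * (b / #S) :=
          card_biUnion_le_card_mul _ _ _ fun i _ => (card_share i).trans_le (min_le_left _ _)
      _ ≤ b := Nat.mul_div_le b #S
  · intro y hy
    obtain ⟨i, hi, hyi⟩ := mem_biUnion.1 hy
    obtain ⟨hyB, rfl⟩ := mem_openBox.1 (share_sub i hyi)
    exact ⟨hyB, hi⟩
  · have hsub : openBox c (B ∪ S.biUnion share) i ⊆ openBox c B i \ share i := by
      intro y hy
      rw [mem_openBox, mem_union, not_or] at hy
      exact mem_sdiff.2 ⟨mem_openBox.2 ⟨hy.1.1, hy.2⟩,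
        fun hyi => hy.1.2 (mem_biUnion.2 ⟨i, hi, hyi⟩)⟩
    have hcard := card_le_card hsub
    rw [card_sdiff_of_subset (share_sub i), card_share] at hcard
    omega

/-- The invariant of Breaker's strategy in the box game: Maker has not touched the boxes in some
nonempty set `S`, and each of them is small enough for Breaker to finish one of them. -/
def BoxInvariant (c : X → ι) (b : ℕ) (M B : Finset X) : Prop :=
  ∃ S : Finset ι, S.Nonempty ∧ (∀ x ∈ M, c x ∉ S) ∧ ∀ i ∈ S, #(openBox c B i) ≤ boxCapacity b #S

theorem BoxInvariant.exists_answer (h : BoxInvariant c b M B) {x : X} (hx : x ∉ M ∪ B) :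
    ∃ Y, Disjoint Y (insert x M ∪ B) ∧ #Y ≤ b ∧ BoxInvariant c b (insert x M) (B ∪ Y) := by
  obtain ⟨S, hS, hM, hcap⟩ := h
  by_cases hxS : c x ∈ S
  swap
  · exact ⟨∅, disjoint_empty_left _, Nat.zero_le _, S, hS, by grind, by simpa using hcap⟩
  have hpos : 1 ≤ #(S.erase (c x)) := by
    by_contra! hlt
    have hone : #S = 1 := by
      have := card_erase_add_one hxS
      omega
    have : 0 < #(openBox c B (c x)) :=
      card_pos.2 ⟨x, mem_openBox.2 ⟨fun hB => hx (mem_union_right M hB), rfl⟩⟩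
    have := hcap _ hxS
    simp only [hone, boxCapacity, Ico_self, sum_empty] at this
    omega
  obtain ⟨Y, hYb, hY, hYcap⟩ := exists_card_openBox_union_le c b B (S.erase (c x))
  refine ⟨Y, ?_, hYb, S.erase (c x), card_pos.1 hpos, by grind, fun i hi => ?_⟩
  · rw [Finset.disjoint_left]
    grind
  · have := hcap i (mem_of_mem_erase hi)
    rw [← card_erase_add_one hxS, boxCapacity_succ b hpos] at this
    have := hYcap i hi
    omega

theorem breakerWins_of_card_fiber_le_boxCapacity [Fintype ι] [Nonempty ι] (c : X → ι)
    (hF : ∀ A ∈ F, ∀ i, ∃ x ∈ A, c x = i)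
    (hcap : ∀ i, #{x | c x = i} ≤ boxCapacity b (Fintype.card ι)) : BreakerWins F b := by
  refine breakerWinsFrom_of_invariant (P := BoxInvariant c b) ?_ ?_ ?_ ?_
  · rintro M B B' hB ⟨S, hS, hM, hcap⟩
    exact ⟨S, hS, hM, fun i hi => (card_le_card (openBox_anti hB i)).trans (hcap i hi)⟩
  · rintro M B ⟨S, ⟨i, hi⟩, hM, -⟩ - A hA hAM
    obtain ⟨x, hxA, rfl⟩ := hF A hA i
    exact hM x (hAM hxA) hi
  · exact fun M B h x hx => h.exists_answer hx
  · refine ⟨univ, univ_nonempty, by simp, fun i _ => ?_⟩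
    simpa only [openBox, compl_empty, card_univ] using hcap i

end BoxGame

section RainbowBreaker

variable {n b : ℕ}

theorem card_colour_class (i : Fin (n - 1)) :
    #{p : RainbowBoard n | p.1 = i} = n.choose 2 := by
  have : ({p : RainbowBoard n | p.1 = i} : Finset _) = {i} ×ˢ univ := by
    ext p
    simp only [mem_filter, mem_product, mem_singleton, mem_univ, true_and, and_true]
  rw [this, card_product, card_singleton, one_mul, card_univ, ← SimpleGraph.edgeFinset_card,
    SimpleGraph.card_edgeFinset_top_eq_card_choose_two, Fintype.card_fin]

theorem breakerWins_rainbowSpanningTrees (hn : 2 ≤ n) (h : n.choose 2 ≤ boxCapacity b (n - 1)) :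
    BreakerWins (rainbowSpanningTrees n) b := by
  have : Nonempty (Fin (n - 1)) := ⟨⟨0, by omega⟩⟩
  refine breakerWins_of_card_fiber_le_boxCapacity Prod.fst (fun T hT i => ?_) fun i => ?_
  · exact (hT.1 i).exists
  · rwa [card_colour_class, Fintype.card_fin]

theorem exists_breakerWins_rainbowSpanningTrees (hn : 3 ≤ n) :
    ∃ b, BreakerWins (rainbowSpanningTrees n) b := by
  refine ⟨n.choose 2, breakerWins_rainbowSpanningTrees (by omega) ?_⟩
  calc n.choose 2 = n.choose 2 / 1 := (Nat.div_one _).symm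
    _ ≤ boxCapacity (n.choose 2) (n - 1) :=
      single_le_sum (f := fun l => n.choose 2 / l) (fun _ _ => Nat.zero_le _)
        (mem_Ico.2 ⟨le_rfl, by omega⟩)

theorem choose_two_le_boxCapacity (hn : 10 ≤ n) (hlog : 10 ≤ Real.log n) :
    n.choose 2 ≤ boxCapacity ⌊(n : ℝ) ^ 2 / Real.log n⌋₊ (n - 1) := by
  have hn' : (10 : ℝ) ≤ n := by exact_mod_cast hn
  have capacity_bound := mul_log_sub_le_boxCapacity ⌊(n : ℝ) ^ 2 / Real.log n⌋₊ (n - 1)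
  rw [Nat.cast_pred (by omega)] at capacity_bound
  have log_pred : Real.log n - 1 ≤ Real.log ((n : ℝ) - 1) := by
    have : Real.log n ≤ Real.log (2 * ((n : ℝ) - 1)) :=
      Real.log_le_log (by linarith) (by linarith)
    rw [Real.log_mul two_ne_zero (by linarith)] at this
    linarith [Real.log_two_lt_d9]
  have log_le : Real.log n ≤ n := Real.log_le_self n.cast_nonneg
  have floor_bound := Nat.lt_floor_add_one ((n : ℝ) ^ 2 / Real.log n)
  set L := Real.log n
  set β := (n : ℝ) ^ 2 / L
  have hβL : β * L = (n : ℝ) ^ 2 := div_mul_cancel₀ _ (by linarith)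
  have hβ : β ≤ (n : ℝ) ^ 2 / 10 :=
    div_le_div_of_nonneg_left (by positivity) (by norm_num) hlog
  have main_term : (β - 1) * (L - 1) ≤ ⌊β⌋₊ * Real.log ((n : ℝ) - 1) :=
    mul_le_mul (by linarith) log_pred (by linarith) (Nat.cast_nonneg _)
  rw [← Nat.cast_le (α := ℝ), Nat.cast_choose_two]
  nlinarith

theorem eventually_breakerWins_rainbowSpanningTrees : ∀ᶠ n : ℕ in atTop,
    BreakerWins (rainbowSpanningTrees n) ⌊(n : ℝ) ^ 2 / Real.log n⌋₊ := by
  have hlog : Tendsto (fun n : ℕ => Real.log n) atTop atTop :=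
    Real.tendsto_log_atTop.comp tendsto_natCast_atTop_atTop
  filter_upwards [eventually_ge_atTop 10, hlog.eventually_ge_atTop 10] with n hn hL
  exact breakerWins_rainbowSpanningTrees (by omega) (choose_two_le_boxCapacity hn hL)

end RainbowBreaker

section ErdosSelfridge

variable {X ι : Type*} [DecidableEq X] {F : Set (Finset X)} {b : ℕ} {β : ℝ}

/-- The biased Erdős–Selfridge potential of a position in the game in which Maker wants to hit all
sets `A a` with `a ∈ s`: a set not yet hit, with `k` elements not owned by Breaker, contributes
`2 ^ (-k / β)`. Here `β` is a real upper bound on the bias of Breaker. -/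
noncomputable def potential (s : Finset ι) (A : ι → Finset X) (β : ℝ) (M B : Finset X) : ℝ :=
  ∑ a ∈ s with Disjoint (A a) M, (2 : ℝ) ^ (-#(A a \ B) / β)

theorem two_rpow_neg_card_sdiff_union_le (hb : (b : ℝ) ≤ β) (hβ : 0 < β) {A B Y : Finset X}
    (hYB : Disjoint Y B) (hY : #Y ≤ b) :
    (2 : ℝ) ^ (-#(A \ (B ∪ Y)) / β) ≤ (2 : ℝ) ^ (-#(A \ B) / β) * (1 + #(A ∩ Y) / β) := by
  have hcard : #(A \ B) = #(A \ (B ∪ Y)) + #(A ∩ Y) := by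
    rw [← card_sdiff_add_card_inter (A \ B) Y, sdiff_sdiff_left, sup_eq_union,
      sdiff_inter_right_comm, inter_sdiff_assoc, hYB.sdiff_eq_left]
  have hle : (#(A ∩ Y) : ℝ) / β ≤ 1 :=
    (div_le_one hβ).2 (le_trans (mod_cast (card_le_card inter_subset_right).trans hY) hb)
  have bernoulli : (2 : ℝ) ^ ((#(A ∩ Y) : ℝ) / β) ≤ 1 + #(A ∩ Y) / β := by
    have := rpow_one_add_le_one_add_mul_self (s := 1) (by norm_num) (by positivity) hle
    rwa [one_add_one_eq_two, mul_one] at this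
  calc (2 : ℝ) ^ (-#(A \ (B ∪ Y)) / β)
      = (2 : ℝ) ^ (-#(A \ B) / β) * (2 : ℝ) ^ ((#(A ∩ Y) : ℝ) / β) := by
        rw [← Real.rpow_add two_pos, hcard]
        push_cast
        ring_nf
    _ ≤ (2 : ℝ) ^ (-#(A \ B) / β) * (1 + #(A ∩ Y) / β) := by gcongr

/-- The part of the potential due to the sets containing `x`, which Maker removes if she claims
`x` and which Breaker increases if he does. -/
noncomputable def danger (s : Finset ι) (A : ι → Finset X) (β : ℝ) (M B : Finset X) (x : X) : ℝ :=
  ∑ a ∈ s with Disjoint (A a) M ∧ x ∈ A a, (2 : ℝ) ^ (-#(A a \ B) / β)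

variable (s : Finset ι) (A : ι → Finset X) (M B : Finset X)

theorem danger_nonneg (x : X) : 0 ≤ danger s A β M B x :=
  sum_nonneg fun _ _ => by positivity

theorem danger_insert_le (x y : X) : danger s A β (insert x M) B y ≤ danger s A β M B y := by
  refine sum_le_sum_of_subset_of_nonneg (fun a ha => ?_) fun _ _ _ => by positivity
  rw [mem_filter, disjoint_insert_right] at ha
  exact mem_filter.2 ⟨ha.1, ha.2.1.2, ha.2.2⟩

theorem potential_insert_add_danger (x : X) :
    potential s A β (insert x M) B + danger s A β M B x = potential s A β M B := by
  simp only [potential, danger, disjoint_insert_right, and_comm (a := x ∉ A _), ← filter_filter]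
  rw [add_comm, sum_filter_add_sum_filter_not]

theorem potential_union_le (hb : (b : ℝ) ≤ β) (hβ : 0 < β) {Y : Finset X} (hYB : Disjoint Y B)
    (hY : #Y ≤ b) :
    potential s A β M (B ∪ Y) ≤ potential s A β M B + (∑ y ∈ Y, danger s A β M B y) / β := by
  have double_count : ∑ y ∈ Y, danger s A β M B y =
      ∑ a ∈ s with Disjoint (A a) M, (2 : ℝ) ^ (-#(A a \ B) / β) * #(A a ∩ Y) := by
    simp only [danger, ← filter_filter]
    rw [sum_congr rfl fun y _ => sum_filter (fun a => y ∈ A a) _, sum_comm]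
    refine sum_congr rfl fun a _ => ?_
    rw [← sum_filter, sum_const, filter_mem_eq_inter, inter_comm, nsmul_eq_mul, mul_comm]
  rw [double_count, sum_div, potential, potential, ← sum_add_distrib]
  refine sum_le_sum fun a _ => (two_rpow_neg_card_sdiff_union_le hb hβ hYB hY).trans_eq ?_
  rw [mul_add, mul_one, mul_div_assoc]

variable [Fintype X] {M B}

theorem exists_potential_le (hb : (b : ℝ) ≤ β) (hβ : 0 < β) (notFull : M ∪ B ≠ univ) :
    ∃ x ∉ M ∪ B, ∀ Y, Disjoint Y (insert x M ∪ B) → #Y ≤ b →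
      potential s A β (insert x M) (B ∪ Y) ≤ potential s A β M B := by
  obtain ⟨x₀, hx₀⟩ := not_forall.1 (mt eq_univ_iff_forall.2 notFull)
  obtain ⟨x, hx, hmax⟩ :=
    exists_max_image (M ∪ B)ᶜ (danger s A β M B) ⟨x₀, mem_compl.2 hx₀⟩
  refine ⟨x, mem_compl.1 hx, fun Y hY hYb => ?_⟩
  have hYB : Disjoint Y B := hY.mono_right subset_union_right
  have danger_le : ∀ y ∈ Y, danger s A β (insert x M) B y ≤ danger s A β M B x := by
    intro y hy
    refine (danger_insert_le s A M B x y).trans (hmax y (mem_compl.2 fun hyMB => ?_))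
    exact Finset.disjoint_left.1 hY hy (union_subset_union_left (subset_insert x M) hyMB)
  calc potential s A β (insert x M) (B ∪ Y)
      ≤ potential s A β (insert x M) B + (∑ y ∈ Y, danger s A β (insert x M) B y) / β :=
        potential_union_le s A _ B hb hβ hYB hYb
    _ ≤ potential s A β (insert x M) B + danger s A β M B x := by
        gcongr
        rw [div_le_iff₀ hβ, mul_comm]
        calc ∑ y ∈ Y, danger s A β (insert x M) B y ≤ #Y * danger s A β M B x := by
              simpa only [nsmul_eq_mul] using sum_le_card_nsmul Y _ _ danger_le
          _ ≤ β * danger s A β M B x :=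
              mul_le_mul_of_nonneg_right (le_trans (mod_cast hYb) hb) (danger_nonneg s A M B x)
    _ = potential s A β M B := potential_insert_add_danger s A M B x

variable {s A}

theorem one_le_potential_of_full (full : M ∪ B = univ) {a : ι} (ha : a ∈ s)
    (hdisj : Disjoint (A a) M) : 1 ≤ potential s A β M B := by
  have hAB : A a \ B = ∅ := by
    rw [sdiff_eq_empty_iff_subset]
    exact fun x hx => (mem_union.1 (full ▸ mem_univ x)).resolve_left
      (Finset.disjoint_left.1 hdisj hx)
  calc (1 : ℝ) = 2 ^ (-#(A a \ B) / β) := by simp [hAB]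
    _ ≤ potential s A β M B :=
      single_le_sum (f := fun a => (2 : ℝ) ^ (-#(A a \ B) / β)) (fun _ _ => by positivity)
        (mem_filter.2 ⟨ha, hdisj⟩)

theorem BreakerWinsFrom.one_le_potential (h : BreakerWinsFrom F b M B) (hb : (b : ℝ) ≤ β)
    (hβ : 0 < β) (hF : ∀ M, (∀ a ∈ s, ¬ Disjoint (A a) M) → ∃ W ∈ F, W ⊆ M) :
    1 ≤ potential s A β M B := by
  induction h with
  | finished M B full noWin =>
    by_contra! hlt
    obtain ⟨W, hW, hWM⟩ := hF M fun a ha hdisj =>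
      hlt.not_ge (one_le_potential_of_full full ha hdisj)
    exact noWin W hW hWM
  | round M B notFull answer free card _ ih =>
    obtain ⟨x, hx, hle⟩ := exists_potential_le s A hb hβ notFull
    exact (ih x hx).trans (hle _ (free x hx) ((card x hx).trans_le (min_le_left _ _)))

theorem not_breakerWins_of_sum_two_rpow_lt_one (hb : (b : ℝ) ≤ β) (hβ : 0 < β)
    (hF : ∀ M, (∀ a ∈ s, ¬ Disjoint (A a) M) → ∃ W ∈ F, W ⊆ M)
    (hsum : ∑ a ∈ s, (2 : ℝ) ^ (-#(A a) / β) < 1) : ¬ BreakerWins F b := by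
  intro h
  have := BreakerWinsFrom.one_le_potential h hb hβ hF
  simp only [potential, disjoint_empty_right, filter_true, sdiff_empty] at this
  linarith

end ErdosSelfridge

section Rado

variable {ι α : Type*} [DecidableEq α]

theorem mem_biUnion_update_erase [DecidableEq ι] {A : ι → Finset α} {i : ι} {z a : α}
    {I : Finset ι} :
    a ∈ I.biUnion (Function.update A i ((A i).erase z)) ↔
      ∃ j ∈ I, a ∈ A j ∧ (j = i → a ≠ z) := by
  rw [mem_biUnion]
  refine exists_congr fun j => and_congr_right fun _ => ?_
  obtain rfl | hji := eq_or_ne j i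
  · simp [and_comm]
  · simp [hji]

theorem exists_erase_rado_condition [DecidableEq ι] {r : Finset α → ℕ} (mono : Monotone r)
    (submod : ∀ E E', r (E ∪ E') + r (E ∩ E') ≤ r E + r E') {A : ι → Finset α}
    (hA : ∀ I : Finset ι, #I ≤ r (I.biUnion A)) {i : ι} (hi : 1 < #(A i)) :
    ∃ z ∈ A i, ∀ I : Finset ι, #I ≤ r (I.biUnion (Function.update A i ((A i).erase z))) := by
  obtain ⟨x, hx, y, hy, hxy⟩ := one_lt_card.1 hi
  by_contra! hcon
  have mem_of_deficient {z : α} {I : Finset ι}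
      (hI : r (I.biUnion (Function.update A i ((A i).erase z))) < #I) : i ∈ I := by
    by_contra hiI
    refine hI.not_ge ((hA I).trans (mono fun a ha => ?_))
    rw [mem_biUnion_update_erase]
    grind
  obtain ⟨I, hI⟩ := hcon x hx
  obtain ⟨J, hJ⟩ := hcon y hy
  have hiIJ : i ∈ I ∩ J := mem_inter.2 ⟨mem_of_deficient hI, mem_of_deficient hJ⟩
  set P := I.biUnion (Function.update A i ((A i).erase x))
  set Q := J.biUnion (Function.update A i ((A i).erase y))
  have hunion : #(I ∪ J) ≤ r (P ∪ Q) := by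
    refine (hA _).trans (mono fun a ha => ?_)
    simp only [P, Q, mem_union, mem_biUnion_update_erase]
    grind
  have hinter : #((I ∩ J).erase i) ≤ r (P ∩ Q) := by
    refine (hA _).trans (mono fun a ha => ?_)
    simp only [P, Q, mem_inter, mem_biUnion_update_erase]
    grind
  have := submod P Q
  have := card_union_add_card_inter I J
  have := card_erase_add_one hiIJ
  omega

/-- **Rado's theorem.** A minimal family with Rado's condition consists of singletons. -/
theorem exists_transversal_card_le_rank [Fintype ι] {r : Finset α → ℕ} (r_empty : r ∅ = 0)
    (mono : Monotone r) (submod : ∀ E E', r (E ∪ E') + r (E ∩ E') ≤ r E + r E')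
    (A : ι → Finset α) (hA : ∀ I : Finset ι, #I ≤ r (I.biUnion A)) :
    ∃ f : ι → α, (∀ i, f i ∈ A i) ∧ Fintype.card ι ≤ r (univ.image f) := by
  classical
  induction hN : ∑ i, #(A i) using Nat.strong_induction_on generalizing A with
  | _ N ih =>
    by_cases hcard : ∀ i, #(A i) ≤ 1
    · have nonempty (i : ι) : (A i).Nonempty := by
        by_contra! hi
        simpa [hi, r_empty] using hA {i}
      choose f hf using nonempty
      refine ⟨f, hf, (hA univ).trans (mono fun a ha => ?_)⟩
      obtain ⟨i, -, hi⟩ := mem_biUnion.1 ha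
      exact mem_image.2 ⟨i, mem_univ i, card_le_one.1 (hcard i) _ (hf i) _ hi⟩
    push Not at hcard
    obtain ⟨i, hi⟩ := hcard
    obtain ⟨z, hz, hA'⟩ := exists_erase_rado_condition mono submod hA hi
    have hsub : Function.update A i ((A i).erase z) ≤ A :=
      update_le_self_iff.2 (erase_subset z (A i))
    have hlt : ∑ j, #(Function.update A i ((A i).erase z) j) < N := by
      rw [← hN]
      refine sum_lt_sum (fun j _ => card_le_card (hsub j)) ⟨i, mem_univ i, ?_⟩
      rw [Function.update_self]
      exact card_erase_lt_of_mem hz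
    obtain ⟨f, hf, hr⟩ := ih _ hlt _ hA' rfl
    exact ⟨f, fun j => hsub j (hf j), hr⟩

end Rado

section GraphRank

variable {V : Type*} {G H : SimpleGraph V}

/-- The rank of the edge set of `G` in the cycle matroid: the number of edges of a spanning forest,
which is the number of vertices minus the number of connected components. -/
noncomputable def graphRank (G : SimpleGraph V) : ℕ := Nat.card V - Nat.card G.ConnectedComponent

variable [Finite V]

theorem graphRank_add_card_connectedComponent (G : SimpleGraph V) :
    graphRank G + Nat.card G.ConnectedComponent = Nat.card V :=
  Nat.sub_add_cancel (Nat.card_le_card_of_surjective _ Quot.mk_surjective)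

theorem graphRank_mono : Monotone (graphRank (V := V)) := fun _ _ h =>
  Nat.sub_le_sub_left (SimpleGraph.ConnectedComponent.card_le_card_of_le h) _

theorem graphRank_bot : graphRank (⊥ : SimpleGraph V) = 0 := by
  have : Function.Injective (⊥ : SimpleGraph V).connectedComponentMk := fun u v h => by
    simpa using h
  exact Nat.sub_eq_zero_of_le (Nat.card_le_card_of_injective _ this)

/-- The functions constant on components form a space of dimension the number of components. The
spaces of `G` and `H` intersect in that of `G ⊔ H` and are contained in that of `G ⊓ H`. -/
theorem card_connectedComponent_add_le (G H : SimpleGraph V) :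
    Nat.card G.ConnectedComponent + Nat.card H.ConnectedComponent ≤
      Nat.card (G ⊔ H).ConnectedComponent + Nat.card (G ⊓ H).ConnectedComponent := by
  classical
  have := Fintype.ofFinite V
  let K (G : SimpleGraph V) : Submodule ℝ (V → ℝ) := LinearMap.ker (Matrix.toLin' (G.lapMatrix ℝ))
  have finrank_K (G : SimpleGraph V) :
      Nat.card G.ConnectedComponent = Module.finrank ℝ (K G) := by
    rw [Nat.card_eq_fintype_card,
      SimpleGraph.card_connectedComponent_eq_finrank_ker_toLin'_lapMatrix]
  have mem_K (G : SimpleGraph V) (f : V → ℝ) : f ∈ K G ↔ ∀ u v, G.Adj u v → f u = f v := by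
    rw [LinearMap.mem_ker, Matrix.toLin'_apply, SimpleGraph.lapMatrix_mulVec_eq_zero_iff_forall_adj]
  have sup_le_inf : K G ⊔ K H ≤ K (G ⊓ H) := by
    refine sup_le ?_ ?_ <;> intro f hf <;> simp only [mem_K, SimpleGraph.inf_adj] at * <;> grind
  have inf_eq_sup : K G ⊓ K H ≤ K (G ⊔ H) := by
    intro f hf
    simp only [Submodule.mem_inf, mem_K, SimpleGraph.sup_adj] at *
    grind
  simp only [finrank_K]
  rw [← Submodule.finrank_sup_add_finrank_inf_eq, add_comm]
  exact add_le_add (Submodule.finrank_mono inf_eq_sup) (Submodule.finrank_mono sup_le_inf)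

theorem graphRank_sup_add_graphRank_inf_le (G H : SimpleGraph V) :
    graphRank (G ⊔ H) + graphRank (G ⊓ H) ≤ graphRank G + graphRank H := by
  have := card_connectedComponent_add_le G H
  have := graphRank_add_card_connectedComponent G
  have := graphRank_add_card_connectedComponent H
  have := graphRank_add_card_connectedComponent (G ⊔ H)
  have := graphRank_add_card_connectedComponent (G ⊓ H)
  omega

/-- Fix a root in every component. A non-isolated root is mapped injectively to a neighbour, which
is not a root. -/
theorem ncard_support_le_two_mul_graphRank (G : SimpleGraph V) :
    G.support.ncard ≤ 2 * graphRank G := by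
  have mk_out (c : G.ConnectedComponent) : G.connectedComponentMk (Quot.out c) = c := Quot.out_eq c
  let R : Set V := Set.range (Quot.out : G.ConnectedComponent → V)
  have ncard_compl_R : Rᶜ.ncard = graphRank G := by
    have : R.ncard = Nat.card G.ConnectedComponent :=
      Set.ncard_range_of_injective (Function.LeftInverse.injective mk_out)
    have := Set.ncard_add_ncard_compl R
    have := graphRank_add_card_connectedComponent G
    omega
  have eq_of_reachable {u v : V} (hu : u ∈ R) (hv : v ∈ R) (h : G.Reachable u v) : u = v := by
    obtain ⟨c, rfl⟩ := hu
    obtain ⟨d, rfl⟩ := hv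
    have hcd : c = d :=
      (mk_out c).symm.trans ((SimpleGraph.ConnectedComponent.sound h).trans (mk_out d))
    rw [hcd]
  have ncard_support_inter_R : (G.support ∩ R).ncard ≤ Rᶜ.ncard := by
    choose! nbr hnbr using fun v (hv : v ∈ G.support) => G.mem_support.1 hv
    refine Set.ncard_le_ncard_of_injOn nbr (fun v hv hR => ?_) fun u hu v hv huv => ?_
    · have := hnbr v hv.1
      exact this.ne (eq_of_reachable hv.2 hR this.reachable)
    · exact eq_of_reachable hu.2 hv.2
        ((hnbr u hu.1).reachable.trans (huv ▸ (hnbr v hv.1).symm.reachable))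
  have ncard_support_diff_R : (G.support \ R).ncard ≤ Rᶜ.ncard :=
    Set.ncard_le_ncard fun v hv => hv.2
  have := Set.ncard_inter_add_ncard_sdiff_eq_ncard G.support R
  omega

theorem exists_balanced_union_of_components [Fintype V] (G : SimpleGraph V) :
    ∃ S : Finset V, 2 * #S ≤ Fintype.card V ∧ Fintype.card V ≤ 2 * #S + 1 + graphRank G ∧
      ∀ u v, G.Adj u v → (u ∈ S ↔ v ∈ S) := by
  classical
  let U (Q : Finset G.ConnectedComponent) : Finset V := {v | G.connectedComponentMk v ∈ Q}
  have card_le_card_U (Q) : #Q ≤ #(U Q) := by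
    refine card_le_card_of_surjOn G.connectedComponentMk fun c hc => ?_
    induction c using SimpleGraph.ConnectedComponent.ind with
    | _ v => exact ⟨v, by simpa [U] using hc, rfl⟩
  have mem_U_iff (Q) (u v : V) (huv : G.Adj u v) : u ∈ U Q ↔ v ∈ U Q := by
    simp only [U, mem_filter_univ, SimpleGraph.ConnectedComponent.sound huv.reachable]
  have U_compl (Q) : U Qᶜ = (U Q)ᶜ := by
    ext v
    simp only [U, mem_filter_univ, mem_compl]
  have hrank := graphRank_add_card_connectedComponent G
  rw [Nat.card_eq_fintype_card, Nat.card_eq_fintype_card] at hrank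
  obtain ⟨Q, -, hQ⟩ := exists_subset_card_eq (s := (univ : Finset G.ConnectedComponent))
    (n := Fintype.card G.ConnectedComponent / 2) (by rw [card_univ]; omega)
  have := card_le_card_U Q
  have := card_le_card_U Qᶜ
  have := card_add_card_compl Q
  have := card_add_card_compl (U Q)
  rw [U_compl] at *
  obtain hle | hle := le_total (2 * #(U Q)) (Fintype.card V)
  · exact ⟨U Q, hle, by omega, mem_U_iff Q⟩
  · refine ⟨U Qᶜ, ?_, ?_, mem_U_iff Qᶜ⟩ <;> rw [U_compl] <;> omega

theorem isTree_fromEdgeSet_of_card_le {E : Finset (Sym2 V)} (hE : #E + 1 ≤ Nat.card V)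
    (hrank : Nat.card V ≤ graphRank (SimpleGraph.fromEdgeSet (E : Set (Sym2 V))) + 1) :
    (SimpleGraph.fromEdgeSet (E : Set (Sym2 V))).IsTree := by
  set G := SimpleGraph.fromEdgeSet (E : Set (Sym2 V))
  have := graphRank_add_card_connectedComponent G
  have : Nonempty V := (Nat.card_pos_iff.1 (by omega)).1
  have : Subsingleton G.ConnectedComponent := Finite.card_le_one_iff_subsingleton.1 (by omega)
  have hconn : G.Connected :=
    ⟨fun u v => SimpleGraph.ConnectedComponent.exact (Subsingleton.elim _ _)⟩
  have card_edgeSet : Nat.card G.edgeSet ≤ #E := by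
    rw [Nat.card_coe_set_eq, ← Set.ncard_coe_finset, SimpleGraph.edgeSet_fromEdgeSet]
    exact Set.ncard_le_ncard Set.sdiff_subset
  have := hconn.card_vert_le_card_edgeSet_add_one
  exact (SimpleGraph.isTree_iff_connected_and_card).2 ⟨hconn, by omega⟩

end GraphRank

section SpanningTrees

variable {V : Type*}

theorem exists_isTree_transversal {ι : Type*} [Fintype ι] [Finite V] [DecidableEq V]
    (A : ι → Finset (Sym2 V)) (hcard : Fintype.card ι + 1 = Nat.card V)
    (hA : ∀ I : Finset ι,
      #I ≤ graphRank (SimpleGraph.fromEdgeSet (I.biUnion A : Set (Sym2 V)))) :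
    ∃ f : ι → Sym2 V, (∀ i, f i ∈ A i) ∧ (SimpleGraph.fromEdgeSet (Set.range f)).IsTree := by
  let r (E : Finset (Sym2 V)) : ℕ := graphRank (SimpleGraph.fromEdgeSet (E : Set (Sym2 V)))
  have r_empty : r ∅ = 0 := by
    simp only [r, coe_empty, SimpleGraph.fromEdgeSet_empty, graphRank_bot]
  have r_mono : Monotone r := fun E E' h =>
    graphRank_mono (SimpleGraph.fromEdgeSet_mono (coe_subset.2 h))
  have r_submod (E E') : r (E ∪ E') + r (E ∩ E') ≤ r E + r E' := by
    simp only [r, coe_union, coe_inter, SimpleGraph.fromEdgeSet_union,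
      SimpleGraph.fromEdgeSet_inter]
    exact graphRank_sup_add_graphRank_inf_le _ _
  obtain ⟨f, hf, hr⟩ := exists_transversal_card_le_rank r_empty r_mono r_submod A hA
  have card_image : #(univ.image f) ≤ Fintype.card ι := card_image_le
  have range_eq : Set.range f = (univ.image f : Finset (Sym2 V)) := by
    rw [coe_image, coe_univ, Set.image_univ]
  refine ⟨f, hf, range_eq ▸ ?_⟩
  exact isTree_fromEdgeSet_of_card_le (by omega) (hcard.ge.trans (Nat.add_le_add_right hr 1))

variable {G : SimpleGraph V} {k : ℕ}

theorem le_graphRank_of_forall_exists_outer_edge [Finite V]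
    (h : ∀ T : Finset V, #T + 2 ≤ 2 * k → ∃ e ∈ G.edgeSet, ∃ v ∈ e, v ∉ T) : k ≤ graphRank G := by
  by_contra! hlt
  have hfin := G.support.toFinite
  have := ncard_support_le_two_mul_graphRank G
  rw [Set.ncard_eq_toFinset_card _ hfin] at this
  obtain ⟨e, he, v, hv, hvT⟩ := h hfin.toFinset (by omega)
  obtain ⟨w, rfl⟩ := Sym2.mem_iff_exists.1 hv
  exact hvT (hfin.mem_toFinset.2 ⟨w, he⟩)

theorem le_graphRank_of_forall_exists_cut_edge [Fintype V]
    (h : ∀ S : Finset V, 2 * #S ≤ Fintype.card V → Fintype.card V ≤ k + 2 * #S →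
      ∃ u ∈ S, ∃ v ∉ S, G.Adj u v) : k ≤ graphRank G := by
  by_contra! hlt
  obtain ⟨S, hle, hge, hadj⟩ := exists_balanced_union_of_components G
  obtain ⟨u, hu, v, hv, huv⟩ := h S hle (by omega)
  exact hv ((hadj u v huv).1 hu)

variable [Fintype V] [DecidableEq V]

/-- The edges of the complete graph on `V` that do not lie inside `T`. -/
def outerEdges (T : Finset V) : Finset (⊤ : SimpleGraph V).edgeSet :=
  {e | ∃ v ∈ (e : Sym2 V), v ∉ T}

/-- The edges of the complete graph on `V` between `S` and its complement. -/
def cutEdges (S : Finset V) : Finset (⊤ : SimpleGraph V).edgeSet :=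
  {e | ∃ u ∈ S, ∃ v ∉ S, (e : Sym2 V) = s(u, v)}

theorem mem_outerEdges {T : Finset V} {e : (⊤ : SimpleGraph V).edgeSet} :
    e ∈ outerEdges T ↔ ∃ v ∈ (e : Sym2 V), v ∉ T :=
  mem_filter_univ _

theorem mem_cutEdges {S : Finset V} {e : (⊤ : SimpleGraph V).edgeSet} :
    e ∈ cutEdges S ↔ ∃ u ∈ S, ∃ v ∉ S, (e : Sym2 V) = s(u, v) :=
  mem_filter_univ _

end SpanningTrees

section RainbowTrees

variable {n : ℕ}

/-- The edges of which Maker, owning `M`, has claimed the copy in the colour `i`. -/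
def colourEdges (M : Finset (RainbowBoard n)) (i : Fin (n - 1)) : Finset (Sym2 (Fin n)) :=
  {p ∈ M | p.1 = i}.image fun p => p.2

variable {M : Finset (RainbowBoard n)} {I : Finset (Fin (n - 1))}

theorem mem_colourEdges {i : Fin (n - 1)} {e : Sym2 (Fin n)} :
    e ∈ colourEdges M i ↔ ∃ he : e ∈ (⊤ : SimpleGraph (Fin n)).edgeSet, (i, ⟨e, he⟩) ∈ M := by
  simp only [colourEdges, mem_image, mem_filter]
  constructor
  · rintro ⟨p, ⟨hp, rfl⟩, rfl⟩
    exact ⟨p.2.2, hp⟩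
  · rintro ⟨he, hM⟩
    exact ⟨_, ⟨hM, rfl⟩, rfl⟩

/-- The graph of the edges that Maker, owning `M`, has claimed in some colour of `I`. -/
def colourGraph (M : Finset (RainbowBoard n)) (I : Finset (Fin (n - 1))) : SimpleGraph (Fin n) :=
  SimpleGraph.fromEdgeSet (I.biUnion (colourEdges M) : Set (Sym2 (Fin n)))

theorem mem_edgeSet_colourGraph {p : RainbowBoard n} (hp : p ∈ M) (hI : p.1 ∈ I) :
    (p.2 : Sym2 (Fin n)) ∈ (colourGraph M I).edgeSet := by
  rw [colourGraph, SimpleGraph.edgeSet_fromEdgeSet]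
  exact ⟨mem_biUnion.2 ⟨p.1, hI, mem_colourEdges.2 ⟨p.2.2, hp⟩⟩,
    SimpleGraph.not_isDiag_of_mem_edgeSet _ p.2.2⟩

theorem exists_rainbowSpanningTree_subset_of_card_le_graphRank (hn : 1 ≤ n)
    (h : ∀ I, #I ≤ graphRank (colourGraph M I)) : ∃ W ∈ rainbowSpanningTrees n, W ⊆ M := by
  obtain ⟨f, hf, htree⟩ := exists_isTree_transversal (colourEdges M) (by simp [hn]) h
  choose hmem hM using fun i => mem_colourEdges.1 (hf i)
  refine ⟨univ.image fun i => (i, ⟨f i, hmem i⟩), ⟨fun i => ?_, ?_⟩, ?_⟩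
  · refine ⟨(i, ⟨f i, hmem i⟩), by simp, ?_⟩
    rintro p ⟨hp, rfl⟩
    obtain ⟨j, -, rfl⟩ := mem_image.1 hp
    rfl
  · convert htree
    ext e
    simp
  · simpa [image_subset_iff] using hM

theorem card_le_graphRank_colourGraph_of_outer
    (h : ∀ T : Finset (Fin n), #T + 2 ≤ 2 * #I → ¬ Disjoint (I ×ˢ outerEdges T) M) :
    #I ≤ graphRank (colourGraph M I) := by
  refine le_graphRank_of_forall_exists_outer_edge fun T hT => ?_
  obtain ⟨p, hp, hpM⟩ := not_disjoint_iff.1 (h T hT)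
  rw [mem_product, mem_outerEdges] at hp
  exact ⟨p.2, mem_edgeSet_colourGraph hpM hp.1, hp.2⟩

theorem card_le_graphRank_colourGraph_of_cut
    (h : ∀ S : Finset (Fin n), 2 * #S ≤ n → n ≤ #I + 2 * #S → ¬ Disjoint (I ×ˢ cutEdges S) M) :
    #I ≤ graphRank (colourGraph M I) := by
  refine le_graphRank_of_forall_exists_cut_edge fun S hle hge => ?_
  rw [Fintype.card_fin] at hle hge
  obtain ⟨p, hp, hpM⟩ := not_disjoint_iff.1 (h S hle hge)
  rw [mem_product, mem_cutEdges] at hp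
  obtain ⟨hpI, u, hu, v, hv, huv⟩ := hp
  refine ⟨u, hu, v, hv, ?_⟩
  rw [← SimpleGraph.mem_edgeSet, ← huv]
  exact mem_edgeSet_colourGraph hpM hpI

end RainbowTrees

section Counting

variable {V : Type*} [Fintype V] [DecidableEq V]

theorem card_cutEdges (S : Finset V) : #(cutEdges S) = #S * #Sᶜ := by
  have adj {p : V × V} (hp : p ∈ S ×ˢ Sᶜ) : s(p.1, p.2) ∈ (⊤ : SimpleGraph V).edgeSet := by
    rw [mem_product, mem_compl] at hp
    exact fun h => hp.2 (h ▸ hp.1)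
  rw [← card_product]
  refine (card_bij (fun p hp => ⟨s(p.1, p.2), adj hp⟩) (fun p hp => ?_) ?_ ?_).symm
  · rw [mem_product, mem_compl] at hp
    exact mem_cutEdges.2 ⟨p.1, hp.1, p.2, hp.2, rfl⟩
  · rintro ⟨u, v⟩ h ⟨u', v'⟩ h' heq
    rw [mem_product, mem_compl] at h h'
    obtain ⟨hu, hv⟩ | ⟨hu, -⟩ := Sym2.eq_iff.1 (congr_arg Subtype.val heq)
    · exact Prod.ext hu hv
    · exact absurd (hu ▸ h.1) h'.2
  · intro e he
    obtain ⟨u, hu, v, hv, huv⟩ := mem_cutEdges.1 he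
    exact ⟨(u, v), mem_product.2 ⟨hu, mem_compl.2 hv⟩, Subtype.ext huv.symm⟩

theorem card_outerEdges_add_choose_two (T : Finset V) :
    #(outerEdges T) + (#T).choose 2 = (Fintype.card V).choose 2 := by
  have image_compl : (outerEdges T)ᶜ.image Subtype.val = T.offDiag.image Sym2.mk.uncurry := by
    ext e
    induction e with
    | _ u v =>
      simp only [mem_image, mem_compl, mem_outerEdges, not_exists, not_and, not_not,
        Subtype.exists, SimpleGraph.mem_edgeSet, SimpleGraph.top_adj, Sym2.mem_iff, mem_offDiag,
        exists_and_left, exists_prop, exists_eq_right_right, forall_eq_or_imp, forall_eq,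
        Prod.exists, Function.uncurry_apply_pair, Sym2.eq_iff]
      grind
  rw [← Sym2.card_image_offDiag, ← image_compl,
    card_image_of_injective _ Subtype.val_injective, card_add_card_compl,
    ← SimpleGraph.edgeFinset_card, SimpleGraph.card_edgeFinset_top_eq_card_choose_two]

theorem sum_inv_pow_card_le {α : Type*} [Fintype α] {n : ℕ} (h : Fintype.card α ≤ n) :
    ∑ I : Finset α, (n : ℝ)⁻¹ ^ #I ≤ 3 :=
  calc ∑ I : Finset α, (n : ℝ)⁻¹ ^ #I
    _ = ((n : ℝ)⁻¹ + 1) ^ Fintype.card α := by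
        simpa using Fintype.sum_pow_mul_eq_add_pow α (n : ℝ)⁻¹ 1
    _ ≤ Real.exp (n : ℝ)⁻¹ ^ Fintype.card α := by
        gcongr
        exact Real.add_one_le_exp _
    _ = Real.exp (Fintype.card α / n) := by rw [← Real.exp_nat_mul, div_eq_mul_inv]
    _ ≤ Real.exp 1 :=
        Real.exp_le_exp.2 (div_le_one_of_le₀ (Nat.cast_le.2 h) n.cast_nonneg)
    _ ≤ 3 := Real.exp_one_lt_three.le

theorem sum_inv_pow_card_add_card_add_one_le {α β : Type*} [Fintype α] [Fintype β] {n : ℕ}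
    (hα : Fintype.card α ≤ n) (hβ : Fintype.card β ≤ n) :
    ∑ q : Finset α × Finset β, (n : ℝ)⁻¹ ^ (#q.1 + #q.2 + 1) ≤ 9 / n :=
  calc ∑ q : Finset α × Finset β, (n : ℝ)⁻¹ ^ (#q.1 + #q.2 + 1)
    _ = (∑ I : Finset α, (n : ℝ)⁻¹ ^ #I) * (∑ T : Finset β, (n : ℝ)⁻¹ ^ #T) * (n : ℝ)⁻¹ := by
        simp only [pow_succ, pow_add, ← sum_mul, Fintype.sum_prod_type, sum_mul_sum]
    _ ≤ 3 * 3 * (n : ℝ)⁻¹ := by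
        gcongr
        exacts [sum_inv_pow_card_le hα, sum_inv_pow_card_le hβ]
    _ = 9 / n := by ring

theorem rpow_neg_le_inv_pow {x y : ℝ} {m : ℕ} (hx : 1 ≤ x) (h : m ≤ y) : x ^ (-y) ≤ x⁻¹ ^ m := by
  rw [inv_pow, ← Real.rpow_natCast, ← Real.rpow_neg (zero_le_one.trans hx)]
  exact Real.rpow_le_rpow_of_exponent_le hx (neg_le_neg h)

end Counting

section Potential

variable {n : ℕ}

theorem add_card_add_one_mul_sq_le_card_outerEdges {i : ℕ} {T : Finset (Fin n)}
    (hT : #T + 2 ≤ 2 * i) (hi : 10 * i ≤ n) :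
    (i + #T + 1) * n ^ 2 ≤ 8 * (i * #(outerEdges T)) := by
  have card_outer := card_outerEdges_add_choose_two T
  rw [Fintype.card_fin] at card_outer
  rify at hT hi card_outer ⊢
  rw [Nat.cast_choose_two, Nat.cast_choose_two] at card_outer
  generalize (#(outerEdges T) : ℝ) = k at *
  have : (0 : ℝ) ≤ #T := Nat.cast_nonneg _
  have quadratic : 3 * (n : ℝ) ^ 2 ≤ 8 * k := by nlinarith
  calc ((i : ℝ) + #T + 1) * n ^ 2
    _ ≤ 3 * i * n ^ 2 := by gcongr; linarith
    _ = i * (3 * n ^ 2) := by ring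
    _ ≤ i * (8 * k) := by gcongr
    _ = 8 * (i * k) := by ring

theorem mul_mul_le_card_cutEdges {S : Finset (Fin n)} (hS : 2 * #S ≤ n) :
    #S * n ≤ 2 * #(cutEdges S) := by
  rw [card_cutEdges, card_compl, Fintype.card_fin, mul_left_comm]
  exact Nat.mul_le_mul_left _ (by omega)

theorem card_compl_add_card_add_one_mul_sq_le_card_cutEdges {I : Finset (Fin (n - 1))}
    {S : Finset (Fin n)} (hI : 9 * n ≤ 10 * #I) (hS : 2 * #S ≤ n) (hIS : n ≤ #I + 2 * #S)
    (hn : 1 ≤ n) :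
    (#Iᶜ + #S + 1) * n ^ 2 ≤ 8 * (#I * #(cutEdges S)) := by
  have := card_compl_add_card I
  rw [Fintype.card_fin] at this
  calc (#Iᶜ + #S + 1) * n ^ 2
    _ ≤ 3 * #S * n ^ 2 := by gcongr; omega
    _ ≤ 4 * #I * (#S * n) := by nlinarith [Nat.mul_le_mul_right (#S * n) hI]
    _ ≤ 4 * #I * (2 * #(cutEdges S)) := Nat.mul_le_mul_left _ (mul_mul_le_card_cutEdges hS)
    _ = 8 * (#I * #(cutEdges S)) := by ring

theorem mul_sq_le_card_cutEdges {i : ℕ} {S : Finset (Fin n)} (hi : n ≤ 10 * i)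
    (hi' : 10 * i ≤ 9 * n) (hS : 2 * #S ≤ n) (hiS : n ≤ i + 2 * #S) :
    n * n ^ 2 ≤ 50 * (8 * (i * #(cutEdges S))) := by
  calc n * n ^ 2
    _ = n * n * n := by ring
    _ ≤ (10 * i) * (20 * #S) * n := by gcongr; omega
    _ = 200 * i * (#S * n) := by ring
    _ ≤ 200 * i * (2 * #(cutEdges S)) := Nat.mul_le_mul_left _ (mul_mul_le_card_cutEdges hS)
    _ = 50 * (8 * (i * #(cutEdges S))) := by ring

/-- The index pairs of the sets `I ×ˢ outerEdges T` that Maker has to hit. -/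
def outerIndices (n : ℕ) : Finset (Finset (Fin (n - 1)) × Finset (Fin n)) :=
  {q | 10 * #q.1 ≤ n ∧ #q.2 + 2 ≤ 2 * #q.1}

/-- The index pairs of the sets `I ×ˢ cutEdges S` that Maker has to hit. -/
def cutIndices (n : ℕ) : Finset (Finset (Fin (n - 1)) × Finset (Fin n)) :=
  {q | n ≤ 10 * #q.1 ∧ 2 * #q.2 ≤ n ∧ n ≤ #q.1 + 2 * #q.2}

theorem sum_outerIndices_le (hn : 1 ≤ n) :
    ∑ q ∈ outerIndices n, (n : ℝ) ^ (-(8 * #(q.1 ×ˢ outerEdges q.2) / n ^ 2 : ℝ)) ≤ 9 / n := by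
  have weight_le (q) (hq : q ∈ outerIndices n) :
      (n : ℝ) ^ (-(8 * #(q.1 ×ˢ outerEdges q.2) / n ^ 2 : ℝ)) ≤ (n : ℝ)⁻¹ ^ (#q.1 + #q.2 + 1) := by
    obtain ⟨hI, hT⟩ := (mem_filter_univ q).1 hq
    refine rpow_neg_le_inv_pow (mod_cast hn) ((le_div_iff₀ (by positivity)).2 ?_)
    rw [card_product]
    exact_mod_cast add_card_add_one_mul_sq_le_card_outerEdges hT hI
  calc _
    _ ≤ ∑ q ∈ outerIndices n, (n : ℝ)⁻¹ ^ (#q.1 + #q.2 + 1) := sum_le_sum weight_le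
    _ ≤ ∑ q : Finset (Fin (n - 1)) × Finset (Fin n), (n : ℝ)⁻¹ ^ (#q.1 + #q.2 + 1) :=
        sum_le_univ_sum_of_nonneg fun q => by positivity
    _ ≤ 9 / n := sum_inv_pow_card_add_card_add_one_le (by simp) (by simp)

/-- If `I` misses fewer than `n / 10` colours, then it is `#Iᶜ` that makes up for the number of
choices of `I`; otherwise the weight is so small that all pairs of sets can be counted. -/
theorem rpow_neg_card_cutEdges_le (hn : 16 ^ 50 ≤ n) {q : Finset (Fin (n - 1)) × Finset (Fin n)}
    (hq : q ∈ cutIndices n) :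
    (n : ℝ) ^ (-(8 * #(q.1 ×ˢ cutEdges q.2) / n ^ 2 : ℝ)) ≤
      (n : ℝ)⁻¹ ^ (#q.1ᶜ + #q.2 + 1) + 16⁻¹ ^ n := by
  have hn1 : 1 ≤ n := le_trans (by norm_num) hn
  have hn' : (16 : ℝ) ^ 50 ≤ n := mod_cast hn
  obtain ⟨hI, hS, hIS⟩ := (mem_filter_univ q).1 hq
  rw [card_product, Nat.cast_mul]
  obtain hdense | hsparse := le_total (9 * n) (10 * #q.1)
  · refine le_add_of_le_of_nonneg (rpow_neg_le_inv_pow (mod_cast hn1) ?_) (by positivity)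
    rw [le_div_iff₀ (by positivity)]
    exact_mod_cast card_compl_add_card_add_one_mul_sq_le_card_cutEdges hdense hS hIS hn1
  · refine le_add_of_nonneg_of_le (by positivity) ?_
    have exponent_ge : (n : ℝ) ≤ 50 * (8 * (#q.1 * #(cutEdges q.2)) / n ^ 2) := by
      rw [← mul_div_assoc, le_div_iff₀ (by positivity)]
      exact_mod_cast mul_sq_le_card_cutEdges hI hsparse hS hIS
    refine le_trans ?_ (rpow_neg_le_inv_pow (by norm_num) exponent_ge)
    rw [← mul_neg, Real.rpow_mul (by norm_num)]
    refine Real.rpow_le_rpow_of_nonpos (by positivity) ?_ (by rw [Left.neg_nonpos_iff]; positivity)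
    exact_mod_cast hn'

theorem sum_cutIndices_le (hn : 16 ^ 50 ≤ n) :
    ∑ q ∈ cutIndices n, (n : ℝ) ^ (-(8 * #(q.1 ×ˢ cutEdges q.2) / n ^ 2 : ℝ)) ≤
      9 / n + 4⁻¹ ^ n :=
  calc _
    _ ≤ ∑ q ∈ cutIndices n, ((n : ℝ)⁻¹ ^ (#q.1ᶜ + #q.2 + 1) + 16⁻¹ ^ n) :=
        sum_le_sum fun q hq => rpow_neg_card_cutEdges_le hn hq
    _ ≤ ∑ q : Finset (Fin (n - 1)) × Finset (Fin n),
          ((n : ℝ)⁻¹ ^ (#q.1ᶜ + #q.2 + 1) + 16⁻¹ ^ n) :=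
        sum_le_univ_sum_of_nonneg fun q => by positivity
    _ = ∑ q : Finset (Fin (n - 1)) × Finset (Fin n), (n : ℝ)⁻¹ ^ (#q.1 + #q.2 + 1) +
          2 ^ (n - 1) * 2 ^ n * 16⁻¹ ^ n := by
        rw [sum_add_distrib, sum_const, nsmul_eq_mul]
        congr 1
        · exact (compl_bijective.prodMap Function.bijective_id).sum_comp
            fun q : Finset (Fin (n - 1)) × Finset (Fin n) => (n : ℝ)⁻¹ ^ (#q.1 + #q.2 + 1)
        · simp
    _ ≤ 9 / n + 2 ^ n * 2 ^ n * 16⁻¹ ^ n := by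
        gcongr
        · exact sum_inv_pow_card_add_card_add_one_le (by simp) (by simp)
        · norm_num
        · omega
    _ = 9 / n + 4⁻¹ ^ n := by
        rw [← mul_pow, ← mul_pow]
        norm_num

theorem two_rpow_neg_div_eq (hn : 2 ≤ n) (k : ℝ) :
    (2 : ℝ) ^ (-k / (Real.log 2 / 8 * (n ^ 2 / Real.log n))) = (n : ℝ) ^ (-(8 * k / n ^ 2)) := by
  have : 0 < Real.log n := Real.log_pos (mod_cast hn)
  rw [Real.rpow_def_of_pos two_pos, Real.rpow_def_of_pos (by positivity)]
  congr 1
  field_simp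

theorem exists_rainbowSpanningTree_subset_of_not_disjoint (hn : 1 ≤ n)
    {M : Finset (RainbowBoard n)}
    (houter : ∀ q ∈ outerIndices n, ¬ Disjoint (q.1 ×ˢ outerEdges q.2) M)
    (hcut : ∀ q ∈ cutIndices n, ¬ Disjoint (q.1 ×ˢ cutEdges q.2) M) :
    ∃ W ∈ rainbowSpanningTrees n, W ⊆ M := by
  refine exists_rainbowSpanningTree_subset_of_card_le_graphRank hn fun I => ?_
  obtain hI | hI := le_total (10 * #I) n
  · exact card_le_graphRank_colourGraph_of_outer fun T hT =>
      houter (I, T) ((mem_filter_univ _).2 ⟨hI, hT⟩)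
  · exact card_le_graphRank_colourGraph_of_cut fun S hS hIS =>
      hcut (I, S) ((mem_filter_univ _).2 ⟨hI, hS, hIS⟩)

theorem not_breakerWins_rainbowSpanningTrees (hn : 16 ^ 50 ≤ n) {b : ℕ}
    (hb : (b : ℝ) ≤ Real.log 2 / 8 * (n ^ 2 / Real.log n)) :
    ¬ BreakerWins (rainbowSpanningTrees n) b := by
  have hn64 : 64 ≤ n := le_trans (by norm_num) hn
  have hlog : 0 < Real.log n := Real.log_pos (by norm_cast; omega)
  refine not_breakerWins_of_sum_two_rpow_lt_one
    (s := (outerIndices n).disjSum (cutIndices n))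
    (A := Sum.elim (fun q => q.1 ×ˢ outerEdges q.2) fun q => q.1 ×ˢ cutEdges q.2)
    hb (by positivity) (fun M hM => ?_) ?_
  · exact exists_rainbowSpanningTree_subset_of_not_disjoint (by omega)
      (fun q hq => hM (.inl q) (inl_mem_disjSum.2 hq))
      (fun q hq => hM (.inr q) (inr_mem_disjSum.2 hq))
  · simp only [sum_disjSum, Sum.elim_inl, Sum.elim_inr, two_rpow_neg_div_eq (show 2 ≤ n by omega)]
    calc _
      _ ≤ 9 / (n : ℝ) + (9 / n + 4⁻¹ ^ n) :=
          add_le_add (sum_outerIndices_le (by omega)) (sum_cutIndices_le hn)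
      _ ≤ 9 / 64 + (9 / 64 + 4⁻¹ ^ 1) := by
          gcongr ?_ + (?_ + ?_)
          · exact div_le_div_of_nonneg_left (by norm_num) (by norm_num) (mod_cast hn64)
          · exact div_le_div_of_nonneg_left (by norm_num) (by norm_num) (mod_cast hn64)
          · exact pow_le_pow_of_le_one (by norm_num) (by norm_num) (by omega)
      _ < 1 := by norm_num

end Potential

section Threshold

theorem exists_tendsto_of_eventually {α E : Type*} [TopologicalSpace E] {l : Filter α}
    {P : α → E → Prop} {a : E} (hex : ∀ x, ∃ e, P x e) (ha : ∀ᶠ x in l, P x a) :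
    ∃ ε : α → E, Tendsto ε l (𝓝 a) ∧ ∀ x, P x (ε x) := by
  classical
  choose e he using hex
  refine ⟨fun x => if P x a then a else e x, ?_, fun x => ?_⟩
  · exact tendsto_const_nhds.congr' (ha.mono fun x hx => (if_pos hx).symm)
  · dsimp only
    split_ifs with hx
    exacts [hx, he x]

theorem eventually_le_of_isThresholdBias {t : ℕ → ℕ}
    (ht : ∀ n, 3 ≤ n → IsThresholdBias (rainbowSpanningTrees n) (t n)) :
    ∀ᶠ n : ℕ in atTop, Real.log 2 / 8 * ((n : ℝ) ^ 2 / Real.log n) ≤ t n := by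
  filter_upwards [eventually_ge_atTop (16 ^ 50)] with n hn
  by_contra! hlt
  exact not_breakerWins_rainbowSpanningTrees hn hlt.le
    ((ht n (le_trans (by norm_num) hn) _).2 le_rfl)

theorem eventually_isThresholdBias_le {t : ℕ → ℕ}
    (ht : ∀ n, 3 ≤ n → IsThresholdBias (rainbowSpanningTrees n) (t n)) :
    ∀ᶠ n : ℕ in atTop, (t n : ℝ) ≤ (n : ℝ) ^ 2 / Real.log n := by
  filter_upwards [eventually_ge_atTop 3, eventually_breakerWins_rainbowSpanningTrees]
    with n hn hwin
  exact (Nat.cast_le.2 ((ht n hn _).1 hwin)).trans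
    (Nat.floor_le (div_nonneg (by positivity) (Real.log_natCast_nonneg n)))

end Threshold

end MakerBreaker

theorem theorem5 :
    ∃ t : ℕ → ℕ,
      (∀ n : ℕ, 3 ≤ n →
        MakerBreaker.IsThresholdBias (MakerBreaker.rainbowSpanningTrees n) (t n)) ∧
      ∃ ε δ : ℕ → ℝ,
        Tendsto ε atTop (𝓝 0) ∧ Tendsto δ atTop (𝓝 0) ∧
        ∀ n : ℕ, 3 ≤ n →
          (Real.log 2 / 8 - ε n) * ((n : ℝ) ^ 2 / Real.log n) ≤ (t n : ℝ) ∧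
          (t n : ℝ) ≤ (1 + δ n) * ((n : ℝ) ^ 2 / Real.log n) := by
  choose! t ht using fun n (hn : 3 ≤ n) =>
    MakerBreaker.exists_isThresholdBias (MakerBreaker.exists_breakerWins_rainbowSpanningTrees hn)
  have scale_pos (n : ℕ) (hn : 3 ≤ n) : 0 < (n : ℝ) ^ 2 / Real.log n :=
    div_pos (by positivity) (Real.log_pos (by norm_cast; omega))
  obtain ⟨ε, hε, lower⟩ := MakerBreaker.exists_tendsto_of_eventually (l := atTop) (a := (0 : ℝ))
    (P := fun (n : ℕ) e => (Real.log 2 / 8 - e) * ((n : ℝ) ^ 2 / Real.log n) ≤ t n)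
    (fun n => ⟨Real.log 2 / 8, by simp⟩)
    (by simpa using MakerBreaker.eventually_le_of_isThresholdBias ht)
  obtain ⟨δ, hδ, upper⟩ := MakerBreaker.exists_tendsto_of_eventually (a := (0 : ℝ))
    (P := fun (n : ℕ) e => 3 ≤ n → t n ≤ (1 + e) * ((n : ℝ) ^ 2 / Real.log n))
    (fun n => ⟨t n / ((n : ℝ) ^ 2 / Real.log n) - 1, fun hn => by
      rw [add_sub_cancel, div_mul_cancel₀ _ (scale_pos n hn).ne']⟩)
    ((MakerBreaker.eventually_isThresholdBias_le ht).mono fun n h _ => by simpa using h)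
  exact ⟨t, ht, ε, δ, hε, hδ, fun n hn => ⟨lower n, upper n hn⟩⟩
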